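/- **Theorem (Completeness of $\mathbf{AA}^\ast$).** Let $\mathcal A$ be a finite set of at least two agents and $P$ a countable set of atoms. Every $\ast$-valid formula is derivable in the infinitary system $\mathbf{AA}^\ast$: if $\vDash^\ast\phi$ then $\phi\in\mathbf{AA}^\ast$. The notions are as follows. *Language.* Formulas: $\phi ::= p \mid \top \mid \lnot\phi \mid (\phi\lor\phi) \mid \hat K_a\phi \mid \langle\phi\rangle\phi \mid \langle a\rangle\phi$ with $p\in P$, $a\in\mathcal A$; $\bot,\land,\to,\leftrightarrow$ are the usual abbreviations, and $K_a\phi:=\lnot\hat K_a\lnot\phi$, $[\psi]\phi:=\lnot\langle\psi\rangle\lnot\phi$, $[a]\phi:=\lnot\langle a\rangle\lnot\phi$. A word is a finite sequence $\alpha$ of agents and formulas; $\epsilon$ is the empty word; $\langle\epsilon\rangle\phi:=\phi$, $\langle\alpha a\rangle\phi:=\langle\alpha\rangle\langle a\rangle\phi$, $\langle\alpha\psi\rangle\phi:=\langle\alpha\rangle\langle\psi\rangle\phi$, $[\alpha]\phi:=\lnot\langle\alpha\rangle\lnot\phi$. Write $|\alpha|_a$ for the number of occurrences of $a$ in $\alpha$,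 $\alpha{\upharpoonright}_!$ for the sequence of the formulas occurring in $\alpha$, $|\alpha|_!$ for its length, and $\alpha{\upharpoonright}_{!a}$ for the initial part of $\alpha{\upharpoonright}_!$ that $a$ has received (each occurrence of $a$ in $\alpha$ receives the next formula sent before it and not yet received by $a$, and nothing if there is none). A history is a word $\alpha$ such that $|\beta|_a\le|\beta|_!$ for all agents $a$ and all prefixes $\beta$ of $\alpha$. For a word $\alpha$ and a history $\beta$, $\alpha\vartriangleright_a\beta$ means $\beta{\upharpoonright}_!=\beta{\upharpoonright}_{!a}=\alpha{\upharpoonright}_{!a}$; for given $a,\alpha$ there are finitely many such $\beta$. *Semantics.* An epistemic model $M=(W,\sim,V)$ has a non-empty set $W$ of states, an equivalence relation $\sim_a$ on $W$ for every $a\in\mathcal A$, and a valuation $V:P\to\mathcal P(W)$. Executability $s\bowtie\alpha$ and satisfaction $s,\alpha\vDash\phi$ are defined by simultaneous recursion: - $s\bowtie\epsilon$ always; $s\bowtie\alpha a$ iff $s\bowtie\alpha$ and $|\alpha|_a<|\alpha|_!$; $s\bowtie\alpha\phi$ iff $s\bowtie\alpha$ and $s,\alpha\vDash\phi$; - $s,\alpha\vDash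 p$ iff $s\bowtie\alpha$ and $s\in V(p)$; $s,\alpha\vDash\top$ iff $s\bowtie\alpha$; $s,\alpha\vDash\lnot\phi$ iff $s\bowtie\alpha$ and $s,\alpha\nvDash\phi$; $s,\alpha\vDash\phi\lor\psi$ iff $s,\alpha\vDash\phi$ or $s,\alpha\vDash\psi$; - $s,\alpha\vDash\hat K_a\phi$ iff $s\bowtie\alpha$ and $t,\beta\vDash\phi$ for some state $t$ and history $\beta$ with $s\sim_a t$, $\alpha\vartriangleright_a\beta$ and $t\bowtie\beta$; - $s,\alpha\vDash\langle a\rangle\phi$ iff $|\alpha|_a<|\alpha|_!$ and $s,\alpha a\vDash\phi$; $s,\alpha\vDash\langle\psi\rangle\phi$ iff $s,\alpha\vDash\psi$ and $s,\alpha\psi\vDash\phi$. A formula $\phi$ is valid ($\vDash\phi$) if $s,\epsilon\vDash\phi$ for all states $s$ of all epistemic models, and $\ast$-valid, or always valid ($\vDash^\ast\phi$), if $[\alpha]\phi$ is valid for every word $\alpha$ (that is, $\phi$ is true after every executable history in every epistemic model). *The system.* Let $\mathsf{empty}:=\bigwedge_{a\in\mathcal A}[a]\bot\land\bigwedge_{a,b\in\mathcal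 A}K_a[b]\bot$. The set $\mathbf{AA}^\ast$ of derivable formulas is the least set that contains, for all formulas $\phi,\psi$, agents $a$, atoms $p$ and words $\alpha$, the axioms - all instances of propositional tautologies; - (Dual) $\hat K_a\phi\leftrightarrow\lnot K_a\lnot\phi$ and $\langle\alpha\rangle\phi\leftrightarrow\lnot[\alpha]\lnot\phi$; - (Dist) $K_a(\phi\to\psi)\to(K_a\phi\to K_a\psi)$; (Dist!) $[\alpha](\phi\to\psi)\to([\alpha]\phi\to[\alpha]\psi)$; - ($\mathsf{empty}$K) $\mathsf{empty}\to K_a\mathsf{empty}$; ($\mathsf{empty}$T) $\mathsf{empty}\to(K_a\phi\to\phi)$; - (4) $K_a\phi\to K_aK_a\phi$; (5) $\hat K_a\phi\to K_a\hat K_a\phi$; - (Exec!$_1$) $\langle\phi\rangle\top\leftrightarrow\phi$; (Exec!$_2$) $[\alpha]\langle a\rangle\top$ if $|\alpha|_a<|\alpha|_!$; (Exec!$_3$) $\mathsf{empty}\to[\alpha][a]\bot$ if $|\alpha|_a\ge|\alpha|_!$; - (Func!) $\langle\alpha\rangle\phi\to[\alpha]\phi$; (Perm!) $(p\to[\alpha]p)\land(\lnot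 p\to[\alpha]\lnot p)$; - ($\mathsf{empty}$!) $\mathsf{empty}\to\bigl([\alpha]K_a\phi\leftrightarrow([\alpha]\bot\lor\bigwedge_{\alpha\vartriangleright_a\beta}K_a[\beta]\phi)\bigr)$; and is closed under the rules - (MP) from $\phi$ and $\phi\to\psi$ infer $\psi$; (NecK) from $\phi$ infer $K_a\phi$; (Nec!) from $\phi$ infer $[\alpha]\phi$; - (R$^\ast$) from $\mathsf{empty}\to[\alpha]\phi$ for all words $\alpha$, infer $\phi$. -/

import Mathlib

universe u v w

namespace AsyncAnn

/-- The language of asynchronous announcement logic over agents `A` and atoms `P`: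
`poss a φ` is `K̂_a φ`, `ann ψ φ` is `⟨ψ⟩φ` (the message `ψ` is sent, then `φ`), and
`rcv a φ` is `⟨a⟩φ` (agent `a` receives the next message, then `φ`). -/
inductive Form (A : Type u) (P : Type v) : Type (max u v) where
  | atom : P → Form A P
  | top : Form A P
  | neg : Form A P → Form A P
  | or : Form A P → Form A P → Form A P
  | poss : A → Form A P → Form A P
  | ann : Form A P → Form A P → Form A P
  | rcv : A → Form A P → Form A P

/-- Words over the alphabet of agents and formulas. A word is stored with its LAST letter at the
head of the list: `x :: α` is the word `α` followed by the letter `x`. So the prefixes of a word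
are the suffixes (`<:+`) of the list. -/
abbrev Word (A : Type u) (P : Type v) : Type (max u v) := List (A ⊕ Form A P)

section Language

variable {A : Type u} {P : Type v}

namespace Form

def bot : Form A P := neg top
def and (φ ψ : Form A P) : Form A P := neg (or (neg φ) (neg ψ))
def imp (φ ψ : Form A P) : Form A P := or (neg φ) ψ
def iff (φ ψ : Form A P) : Form A P := and (imp φ ψ) (imp ψ φ)
/-- `K_a φ := ¬ K̂_a ¬ φ`. -/
def know (a : A) (φ : Form A P) : Form A P := neg (poss a (neg φ))
/-- `[a] φ := ¬ ⟨a⟩ ¬ φ`. -/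
def boxRcv (a : A) (φ : Form A P) : Form A P := neg (rcv a (neg φ))

/-- Finite conjunctions; the empty one is `⊤`. -/
def conj (L : List (Form A P)) : Form A P := L.foldr and top

/-- `⟨α⟩φ`, with `⟨ε⟩φ = φ`, `⟨αa⟩φ = ⟨α⟩⟨a⟩φ`, `⟨αψ⟩φ = ⟨α⟩⟨ψ⟩φ`. -/
def dia : Word A P → Form A P → Form A P
  | [], φ => φ
  | Sum.inl a :: α, φ => dia α (rcv a φ)
  | Sum.inr ψ :: α, φ => dia α (ann ψ φ)

/-- `[α]φ := ¬ ⟨α⟩ ¬ φ`. -/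
def box (α : Word A P) (φ : Form A P) : Form A P := neg (dia α (neg φ))

/-- Modal depth. -/
def deg : Form A P → ℕ
  | atom _ => 0
  | top => 0
  | neg φ => deg φ
  | or φ ψ => max (deg φ) (deg ψ)
  | poss _ φ => deg φ + 1
  | ann ψ φ => deg ψ + deg φ
  | rcv _ φ => deg φ

/-- Size. -/
def size : Form A P → ℕ
  | atom _ => 2
  | top => 1
  | neg φ => size φ + 1
  | or φ ψ => size φ + size ψ
  | poss _ φ => size φ + 1
  | ann ψ φ => 2 * size ψ + size φ
  | rcv _ φ => size φ + 2

theorem size_pos (φ : Form A P) : 0 < size φ := by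
  induction φ <;> simp only [size] <;> omega

/-- Truth value of a formula under an assignment `e` of truth values to all the formulas that are
not built by `⊤`, `¬`, `∨`. -/
def propEval (e : Form A P → Prop) : Form A P → Prop
  | top => True
  | neg φ => ¬ propEval e φ
  | or φ ψ => propEval e φ ∨ propEval e ψ
  | atom p => e (atom p)
  | poss a φ => e (poss a φ)
  | ann ψ φ => e (ann ψ φ)
  | rcv a φ => e (rcv a φ)

/-- Instances of propositional tautologies. -/
def IsTautology (φ : Form A P) : Prop := ∀ e : Form A P → Prop, propEval e φ

end Form

namespace Word

/-- `|α|_a`, the number of occurrences of the letter `a`. -/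
noncomputable def numRcv (a : A) : Word A P → ℕ
  | [] => 0
  | Sum.inl b :: α => open Classical in if b = a then numRcv a α + 1 else numRcv a α
  | Sum.inr _ :: α => numRcv a α

/-- `α↾!`, the list of the formulas that occur in `α`, in the order in which they were sent. -/
def sent (α : Word A P) : List (Form A P) := (α.filterMap Sum.getRight?).reverse

/-- `|α|_!`, the number of formula occurrences. -/
def numSent (α : Word A P) : ℕ := (sent α).length

/-- `|α|_{!a}`, the number of formula occurrences received by `a`: a letter `a` receives the next
formula that `a` has not yet received, and nothing if there is none. -/
noncomputable def numRead (a : A) : Word A P → ℕ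
  | [] => 0
  | Sum.inl b :: α =>
      open Classical in
      if b = a ∧ numRead a α < numSent α then numRead a α + 1 else numRead a α
  | Sum.inr _ :: α => numRead a α

/-- `α↾!a`, the list of the formulas that agent `a` has received. -/
noncomputable def read (a : A) (α : Word A P) : List (Form A P) := (sent α).take (numRead a α)

/-- Histories: no prefix holds more receptions by an agent than sent formulas. -/
def IsHistory (α : Word A P) : Prop := ∀ β : Word A P, β <:+ α → ∀ a : A, numRcv a β ≤ numSent β

/-- The view relation `α ▷_a β`. -/
def View (a : A) (α β : Word A P) : Prop :=
  IsHistory β ∧ sent β = read a β ∧ read a β = read a α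

/-- Sum of the modal depths of the formulas of a word. -/
def deg (α : Word A P) : ℕ := ((sent α).map Form.deg).sum

/-- Size of a word. -/
def size : Word A P → ℕ
  | [] => 0
  | Sum.inl _ :: α => size α + 1
  | Sum.inr φ :: α => size α + φ.size

@[simp] theorem sent_nil : sent ([] : Word A P) = [] := rfl

@[simp] theorem sent_inl (a : A) (α : Word A P) : sent (Sum.inl a :: α) = sent α := by
  simp [sent, List.filterMap_cons]

@[simp] theorem sent_inr (φ : Form A P) (α : Word A P) :
    sent (Sum.inr φ :: α) = sent α ++ [φ] := by
  simp [sent]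

theorem deg_inl (a : A) (α : Word A P) : deg (Sum.inl a :: α) = deg α := by simp [deg]

theorem deg_inr (φ : Form A P) (α : Word A P) : deg (Sum.inr φ :: α) = deg α + φ.deg := by
  simp [deg]

theorem deg_le_of_view {a : A} {α β : Word A P} (h : View a α β) : deg β ≤ deg α := by
  obtain ⟨_, h1, h2⟩ := h
  have h3 : sent β = (sent α).take (numRead a α) := h1.trans h2
  unfold deg
  rw [h3]
  exact ((List.take_sublist _ _).map _).sum_le_sum (fun _ _ => Nat.zero_le _)

theorem length_eq [Fintype A] (α : Word A P) :
    α.length = (∑ a : A, numRcv a α) + numSent α := by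
  classical
  induction α with
  | nil => simp [numRcv, numSent]
  | cons x α ih =>
    rcases x with b | φ
    · have : ∀ a : A, numRcv a (Sum.inl b :: α : Word A P)
          = numRcv a α + if b = a then 1 else 0 := by
        intro a; simp only [numRcv]; split_ifs <;> simp
      simp only [this, Finset.sum_add_distrib, Finset.sum_ite_eq, Finset.mem_univ, if_true,
        List.length_cons, ih, numSent, sent_inl]
      omega
    · have : ∀ a : A, numRcv a (Sum.inr φ :: α : Word A P) = numRcv a α := by
        intro a; rfl
      simp only [this, List.length_cons, ih, numSent, sent_inr, List.length_append,
        List.length_nil]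
      omega

theorem mem_sent {φ : Form A P} {α : Word A P} (h : Sum.inr φ ∈ α) : φ ∈ sent α := by
  simpa [sent, List.mem_filterMap] using h

/-- The view of an agent is a finite set of histories. -/
theorem view_finite [Fintype A] (a : A) (α : Word A P) : {β : Word A P | View a α β}.Finite := by
  classical
  let S : Finset (A ⊕ Form A P) :=
    Finset.univ.map Function.Embedding.inl ∪ ((sent α).map Sum.inr).toFinset
  let N : ℕ := Fintype.card A * numSent α + numSent α
  have hfin : {l : List S | l.length ≤ N}.Finite := List.finite_length_le S N
  refine (hfin.image (List.map Subtype.val)).subset ?_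
  rintro β ⟨hH, h1, h2⟩
  have h3 : sent β = (sent α).take (numRead a α) := h1.trans h2
  have hn : numSent β ≤ numSent α := by
    unfold numSent; rw [h3]; exact List.length_take_le' _ _
  have hS : ∀ x ∈ β, x ∈ S := by
    rintro (b | φ) hx
    · simp [S]
    · have := mem_sent hx
      rw [h3] at this
      simp [S, List.mem_of_mem_take this]
  refine ⟨β.attach.map (fun x => ⟨x.1, hS x.1 x.2⟩), ?_, ?_⟩
  · simp only [Set.mem_ofPred_eq, List.length_map, List.length_attach]
    rw [length_eq β]
    have : ∑ b : A, numRcv b β ≤ Fintype.card A * numSent α := by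
      calc ∑ b : A, numRcv b β ≤ ∑ _b : A, numSent α :=
            Finset.sum_le_sum (fun b _ => (hH β List.suffix_rfl b).trans hn)
        _ = _ := by simp
    simp only [N]; omega
  · rw [List.map_map]
    exact List.attach_map_subtype_val β

/-- `view_a(α)`, the finite set of all `β` such that `α ▷_a β`. -/
noncomputable def view [Fintype A] (a : A) (α : Word A P) : Finset (Word A P) :=
  (view_finite a α).toFinset

end Word

end Language

section Semantics

/-- Epistemic models: a non-empty set of states, an equivalence relation on it for each agent, and
a valuation. -/
structure Model (A : Type u) (P : Type v) where
  W : Type w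
  nonempty : Nonempty W
  rel : A → W → W → Prop
  equiv : ∀ a, Equivalence (rel a)
  val : P → Set W

variable {A : Type u} {P : Type v}

/- Executability `s ⋈ α` and satisfaction `s, α ⊨ φ`, by simultaneous well-founded recursion on
the depth of `⟨α⟩φ`, then on the size of `α` plus the size of `φ`. -/
mutual

def Exec (M : Model.{u, v, w} A P) (s : M.W) : (α : Word A P) → Prop
  | [] => True
  | Sum.inl a :: α => Exec M s α ∧ Word.numRcv a α < Word.numSent α
  | Sum.inr φ :: α => Exec M s α ∧ Sat M s α φ
termination_by α => (Word.deg α, Word.size α, 1)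
decreasing_by
  · rw [Word.deg_inl]
    exact Prod.Lex.right _ (Prod.Lex.left _ _ (by simp [Word.size]))
  · rw [Word.deg_inr]
    have := φ.size_pos
    rcases Nat.eq_zero_or_pos φ.deg with h | h
    · rw [h]
      exact Prod.Lex.right _ (Prod.Lex.left _ _ (by simp only [Word.size]; omega))
    · exact Prod.Lex.left _ _ (by omega)
  · rw [Word.deg_inr]
    exact Prod.Lex.right _ (Prod.Lex.right _ (by omega))

def Sat (M : Model.{u, v, w} A P) (s : M.W) (α : Word A P) : (φ : Form A P) → Prop
  | Form.atom p => Exec M s α ∧ s ∈ M.val p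
  | Form.top => Exec M s α
  | Form.neg φ => Exec M s α ∧ ¬ Sat M s α φ
  | Form.or φ ψ => Sat M s α φ ∨ Sat M s α ψ
  | Form.poss a φ => Exec M s α ∧
      ∃ (t : M.W) (β : Word A P), M.rel a s t ∧ ∃ _h : Word.View a α β, Exec M t β ∧ Sat M t β φ
  | Form.rcv a φ => Word.numRcv a α < Word.numSent α ∧ Sat M s (Sum.inl a :: α) φ
  | Form.ann ψ φ => Sat M s α ψ ∧ Sat M s (Sum.inr ψ :: α) φ
termination_by φ => (Word.deg α + φ.deg, Word.size α + φ.size, 0)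
decreasing_by
  all_goals simp only [Prod.lex_def, Form.deg, Form.size, Word.deg_inl, Word.deg_inr, Word.size, true_and]
  all_goals first
    | omega
    | (have h1 := Form.size_pos φ; omega)
    | (have h1 := Form.size_pos φ; have h2 := Form.size_pos ψ; omega)
    | (have := Word.deg_le_of_view ‹Word.View _ _ _›; omega)

end

/- The defining clauses. -/

theorem exec_nil (M : Model.{u, v, w} A P) (s : M.W) : Exec M s [] ↔ True := by
  rw [Exec]

theorem exec_inl (M : Model.{u, v, w} A P) (s : M.W) (α : Word A P) (a : A) :
    Exec M s (Sum.inl a :: α) ↔ Exec M s α ∧ Word.numRcv a α < Word.numSent α := by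
  rw [Exec]

theorem exec_inr (M : Model.{u, v, w} A P) (s : M.W) (α : Word A P) (φ : Form A P) :
    Exec M s (Sum.inr φ :: α) ↔ Exec M s α ∧ Sat M s α φ := by
  rw [Exec]

theorem sat_atom (M : Model.{u, v, w} A P) (s : M.W) (α : Word A P) (p : P) :
    Sat M s α (Form.atom p) ↔ Exec M s α ∧ s ∈ M.val p := by
  rw [Sat]

theorem sat_top (M : Model.{u, v, w} A P) (s : M.W) (α : Word A P) :
    Sat M s α Form.top ↔ Exec M s α := by
  rw [Sat]

theorem sat_neg (M : Model.{u, v, w} A P) (s : M.W) (α : Word A P) (φ : Form A P) :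
    Sat M s α (Form.neg φ) ↔ Exec M s α ∧ ¬ Sat M s α φ := by
  rw [Sat]

theorem sat_or (M : Model.{u, v, w} A P) (s : M.W) (α : Word A P) (φ ψ : Form A P) :
    Sat M s α (Form.or φ ψ) ↔ Sat M s α φ ∨ Sat M s α ψ := by
  rw [Sat]

theorem sat_poss (M : Model.{u, v, w} A P) (s : M.W) (α : Word A P) (a : A) (φ : Form A P) :
    Sat M s α (Form.poss a φ) ↔ Exec M s α ∧ ∃ (t : M.W) (β : Word A P),
      M.rel a s t ∧ Word.View a α β ∧ Exec M t β ∧ Sat M t β φ := by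
  rw [Sat]; simp only [exists_prop]

theorem sat_rcv (M : Model.{u, v, w} A P) (s : M.W) (α : Word A P) (a : A) (φ : Form A P) :
    Sat M s α (Form.rcv a φ) ↔
      Word.numRcv a α < Word.numSent α ∧ Sat M s (Sum.inl a :: α) φ := by
  rw [Sat]

theorem sat_ann (M : Model.{u, v, w} A P) (s : M.W) (α : Word A P) (ψ φ : Form A P) :
    Sat M s α (Form.ann ψ φ) ↔ Sat M s α ψ ∧ Sat M s (Sum.inr ψ :: α) φ := by
  rw [Sat]

/-- `ε`-validity: truth in all states of all models, with the empty history. -/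
def Valid (φ : Form A P) : Prop := ∀ (M : Model.{u, v, w} A P) (s : M.W), Sat M s [] φ

/-- `∗`-validity: `[α]φ` is `ε`-valid for all words `α`. -/
def AlwaysValid (φ : Form A P) : Prop := ∀ α : Word A P, Valid.{u, v, w} (Form.box α φ)

end Semantics

section ProofSystem

variable {A : Type u} {P : Type v} [Fintype A]

open Form Word

/-- The formula `empty`: the conjunction of all `[a]⊥` and of all `K_a [b]⊥`. -/
noncomputable def emptyForm : Form A P :=
  and (conj ((Finset.univ : Finset A).toList.map fun a => boxRcv a bot))
    (conj ((Finset.univ : Finset (A × A)).toList.map fun ab => know ab.1 (boxRcv ab.2 bot)))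

/-- Derivability in the infinitary system `AA∗`. The schemas `dualK` and `dualBox` make the
primitive diamonds and the boxes defined from them duals of each other. -/
inductive Derivable : Form A P → Prop
  | taut {φ : Form A P} : IsTautology φ → Derivable φ
  | dualK (a : A) (φ : Form A P) : Derivable (iff (poss a φ) (neg (know a (neg φ))))
  | dualBox (α : Word A P) (φ : Form A P) : Derivable (iff (dia α φ) (neg (box α (neg φ))))
  | distK (a : A) (φ ψ : Form A P) :
      Derivable (imp (know a (imp φ ψ)) (imp (know a φ) (know a ψ)))
  | distBox (α : Word A P) (φ ψ : Form A P) :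
      Derivable (imp (box α (imp φ ψ)) (imp (box α φ) (box α ψ)))
  | emptyK (a : A) : Derivable (imp emptyForm (know a emptyForm))
  | emptyT (a : A) (φ : Form A P) : Derivable (imp emptyForm (imp (know a φ) φ))
  | four (a : A) (φ : Form A P) : Derivable (imp (know a φ) (know a (know a φ)))
  | five (a : A) (φ : Form A P) : Derivable (imp (poss a φ) (know a (poss a φ)))
  | exec₁ (φ : Form A P) : Derivable (iff (ann φ top) φ)
  | exec₂ (α : Word A P) (a : A) : numRcv a α < numSent α → Derivable (box α (rcv a top))
  | exec₃ (α : Word A P) (a : A) :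
      numSent α ≤ numRcv a α → Derivable (imp emptyForm (box α (boxRcv a bot)))
  | func (α : Word A P) (φ : Form A P) : Derivable (imp (dia α φ) (box α φ))
  | perm (α : Word A P) (p : P) :
      Derivable (and (imp (atom p) (box α (atom p))) (imp (neg (atom p)) (box α (neg (atom p)))))
  | emptyBox (α : Word A P) (a : A) (φ : Form A P) :
      Derivable (imp emptyForm (iff (box α (know a φ))
        (or (box α bot) (conj ((view a α).toList.map fun β => know a (box β φ))))))
  | mp {φ ψ : Form A P} : Derivable φ → Derivable (imp φ ψ) → Derivable ψ
  | necK (a : A) {φ : Form A P} : Derivable φ → Derivable (know a φ)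
  | necBox (α : Word A P) {φ : Form A P} : Derivable φ → Derivable (box α φ)
  | rStar {φ : Form A P} : (∀ α : Word A P, Derivable (imp emptyForm (box α φ))) → Derivable φ

end ProofSystem

end AsyncAnn

/-!
The rule `rStar` reduces the claim to completeness for `ε`-validity relative to `empty`: it
suffices that `empty → [α]φ` is derivable as soon as `[α]φ` is `ε`-valid, for each word `α`. The
latter is shown with a canonical model.

A world of the canonical model is a truth assignment to the formulas not built by `⊤`, `¬`, `∨`
under which all derivable formulas and `empty` come out true. Such assignments play the part of
maximal consistent sets, and compactness of `Form A P → Bool` plays the part of Lindenbaum's lemma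
(`exists_propEval_of_notMem`): a set of formulas that contains the tautologies and is closed under
modus ponens is the set of formulas true under all the assignments that satisfy it. Since `empty`
is passed on to epistemic successors and yields `K_a φ → φ`, the canonical relations are equivalence
relations.

The truth lemma (`sat_canonical`) states that `s, α ⊨ φ` iff `⟨α⟩φ` is true in the world `s`. It is
proved together with `exec_canonical` (`s ⋈ α` iff `⟨α⟩⊤` is true in `s`) by the recursion that
defines satisfaction. The axioms serve as reduction axioms there: in the presence of `empty` they
determine the truth value of `⟨α⟩φ` from those of formulas `⟨β⟩ψ` that are smaller in this recursion.
-/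

namespace AsyncAnn

section Completeness

variable {A : Type u} {P : Type v}

open Form Word

/-! ### Truth assignments -/

section PropEval

variable (e : Form A P → Prop)

@[simp] theorem propEval_top : propEval e (top : Form A P) ↔ True := Iff.rfl

@[simp] theorem propEval_neg (φ : Form A P) : propEval e (neg φ) ↔ ¬ propEval e φ := Iff.rfl

@[simp] theorem propEval_or (φ ψ : Form A P) :
    propEval e (or φ ψ) ↔ propEval e φ ∨ propEval e ψ := Iff.rfl

@[simp] theorem propEval_bot : propEval e (bot : Form A P) ↔ False := by
  simp [bot]

@[simp] theorem propEval_and (φ ψ : Form A P) :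
    propEval e (Form.and φ ψ) ↔ propEval e φ ∧ propEval e ψ := by
  simp [Form.and]

@[simp] theorem propEval_imp (φ ψ : Form A P) :
    propEval e (imp φ ψ) ↔ (propEval e φ → propEval e ψ) := by
  simp [imp, imp_iff_not_or]

@[simp] theorem propEval_iff (φ ψ : Form A P) :
    propEval e (Form.iff φ ψ) ↔ (propEval e φ ↔ propEval e ψ) := by
  simp [Form.iff, iff_def]

@[simp] theorem propEval_know (a : A) (φ : Form A P) :
    propEval e (know a φ) ↔ ¬ propEval e (poss a (neg φ)) := Iff.rfl

@[simp] theorem propEval_box (α : Word A P) (φ : Form A P) :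
    propEval e (box α φ) ↔ ¬ propEval e (dia α (neg φ)) := Iff.rfl

@[simp] theorem propEval_boxRcv (a : A) (φ : Form A P) :
    propEval e (boxRcv a φ) ↔ ¬ propEval e (rcv a (neg φ)) := Iff.rfl

@[simp] theorem propEval_conj (L : List (Form A P)) :
    propEval e (conj L) ↔ ∀ χ ∈ L, propEval e χ := by
  induction L with
  | nil => simp [conj]
  | cons χ L ih =>
    have h : conj (χ :: L) = Form.and χ (conj L) := rfl
    simp [h, ih]

end PropEval

/-- Assignments are taken `Bool`-valued here, because the product topology on functions into the
discrete space `Bool` is compact, with the truth set of every formula clopen. -/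
theorem isClopen_setOf_propEval (φ : Form A P) :
    IsClopen {b : Form A P → Bool | propEval (fun χ => b χ = true) φ} := by
  have hprim (χ : Form A P) : IsClopen {b : Form A P → Bool | b χ = true} :=
    (isClopen_discrete {true}).preimage (continuous_apply χ)
  induction φ with
  | top => exact isClopen_univ
  | neg φ ih => exact ih.compl
  | or φ ψ ih₁ ih₂ => exact ih₁.union ih₂
  | atom p => exact hprim _
  | poss a φ => exact hprim _
  | ann ψ φ => exact hprim _
  | rcv a φ => exact hprim _

theorem mem_of_finset_entails {Γ : Set (Form A P)} (htaut : ∀ φ, IsTautology φ → φ ∈ Γ)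
    (hmp : ∀ φ ψ, φ ∈ Γ → imp φ ψ ∈ Γ → ψ ∈ Γ) (T : Finset (Form A P)) (hT : ∀ χ ∈ T, χ ∈ Γ)
    (φ : Form A P) (h : ∀ e, (∀ χ ∈ T, propEval e χ) → propEval e φ) : φ ∈ Γ := by
  classical
  induction T using Finset.induction_on generalizing φ with
  | empty => exact htaut φ fun e => h e (by simp)
  | insert χ T _ ih =>
    refine hmp χ φ (hT χ (by simp)) (ih (fun ψ hψ => hT ψ (by simp [hψ])) _ fun e he => ?_)
    rw [propEval_imp]
    intro hχ
    refine h e fun ψ hψ => ?_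
    rcases Finset.mem_insert.1 hψ with rfl | hψ
    exacts [hχ, he ψ hψ]

/-- The substitute for Lindenbaum's lemma: a formula outside a deductively closed set is refuted by
an assignment that satisfies the set. -/
theorem exists_propEval_of_notMem {Γ : Set (Form A P)} (htaut : ∀ φ, IsTautology φ → φ ∈ Γ)
    (hmp : ∀ φ ψ, φ ∈ Γ → imp φ ψ ∈ Γ → ψ ∈ Γ) {φ : Form A P} (hφ : φ ∉ Γ) :
    ∃ e : Form A P → Prop, (∀ χ ∈ Γ, propEval e χ) ∧ ¬ propEval e φ := by
  by_contra! hcon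
  have hempty : {b : Form A P → Bool | propEval (fun χ => b χ = true) (neg φ)} ∩
      ⋂ χ : Γ, {b : Form A P → Bool | propEval (fun χ => b χ = true) χ.1} = ∅ := by
    refine Set.eq_empty_of_forall_notMem fun b hb => hb.1 (hcon _ fun χ hχ => ?_)
    exact Set.mem_iInter.1 hb.2 ⟨χ, hχ⟩
  obtain ⟨T, hT⟩ := (isClopen_setOf_propEval (neg φ)).isClosed.isCompact.elim_finite_subfamily_closed
    _ (fun χ : Γ => (isClopen_setOf_propEval χ.1).isClosed) hempty
  refine hφ (mem_of_finset_entails htaut hmp (T.map (Function.Embedding.subtype _)) ?_ φ ?_)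
  · simp +contextual
  · intro e he
    classical
    by_contra hne
    have hdec : (fun χ => decide (e χ) = true) = e := by simp
    have hmem : (fun χ => decide (e χ)) ∈ (∅ : Set (Form A P → Bool)) := by
      rw [← hT]
      refine ⟨?_, Set.mem_iInter₂.2 fun χ hχ => ?_⟩
      · change propEval (fun χ => decide (e χ) = true) (neg φ)
        rw [hdec]; exact hne
      · change propEval (fun χ => decide (e χ) = true) χ.1
        rw [hdec]; exact he _ (Finset.mem_map_of_mem _ hχ)
    exact hmem

/-! ### Sound assignments -/

variable [Fintype A]

/-- An assignment is sound if all derivable formulas are true under it. -/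
def IsSound (e : Form A P → Prop) : Prop := ∀ φ, Derivable φ → propEval e φ

theorem derivable_of_isSound {φ : Form A P} (h : ∀ e, IsSound e → propEval e φ) :
    Derivable φ := by
  by_contra hφ
  obtain ⟨e, he, hne⟩ := exists_propEval_of_notMem (Γ := {χ : Form A P | Derivable χ})
    (fun _ => .taut) (fun _ _ => .mp) hφ
  exact hne (h e he)

namespace IsSound

variable {e : Form A P → Prop}

theorem dia_not_not (he : IsSound e) (α : Word A P) (φ : Form A P) :
    propEval e (dia α (neg (neg φ))) ↔ propEval e (dia α φ) := by
  simpa using ((propEval_iff _ _ _).1 (he _ (.dualBox α φ))).symm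

theorem poss_not_not (he : IsSound e) (a : A) (φ : Form A P) :
    propEval e (poss a (neg (neg φ))) ↔ propEval e (poss a φ) := by
  simpa using ((propEval_iff _ _ _).1 (he _ (.dualK a φ))).symm

theorem dia_mono (he : IsSound e) (α : Word A P) {φ ψ : Form A P}
    (h : ∀ f, IsSound f → propEval f φ → propEval f ψ)
    (hφ : propEval e (dia α φ)) : propEval e (dia α ψ) := by
  have hd : Derivable (imp (neg ψ) (neg φ)) := derivable_of_isSound fun f hf => by
    simpa using fun hψ hφ => hψ (h f hf hφ)
  have h₁ := he _ (.necBox α hd)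
  have h₂ := he _ (.distBox α (neg ψ) (neg φ))
  rw [propEval_imp, propEval_imp, propEval_box _ _ (neg ψ), propEval_box _ _ (neg φ),
    he.dia_not_not, he.dia_not_not] at h₂
  exact not_imp_not.1 (h₂ h₁) hφ

theorem dia_congr (he : IsSound e) (α : Word A P) {φ ψ : Form A P}
    (h : ∀ f, IsSound f → (propEval f φ ↔ propEval f ψ)) :
    propEval e (dia α φ) ↔ propEval e (dia α ψ) :=
  ⟨he.dia_mono α fun f hf => (h f hf).1, he.dia_mono α fun f hf => (h f hf).2⟩

theorem dia_top (he : IsSound e) (α : Word A P) {φ : Form A P} (h : propEval e (dia α φ)) :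
    propEval e (dia α top) :=
  he.dia_mono α (fun _ _ _ => trivial) h

/-- The semantic clause for negation; `func` says that words act as partial functions. -/
theorem dia_neg (he : IsSound e) (α : Word A P) (φ : Form A P) :
    propEval e (dia α (neg φ)) ↔ propEval e (dia α top) ∧ ¬ propEval e (dia α φ) := by
  refine ⟨fun h => ⟨he.dia_top α h, fun hφ => ?_⟩, fun ⟨ht, hφ⟩ => ?_⟩
  · have := he _ (.func α φ)
    simp only [propEval_imp, propEval_box] at this
    exact this hφ h
  · -- Otherwise `[α]φ` and `[α](φ → ⊥)` are both true, hence `[α]⊥`, which contradicts `⟨α⟩⊤`.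
    by_contra hn
    have h₁ := he _ (.distBox α φ bot)
    simp only [propEval_imp, propEval_box] at h₁
    refine h₁ ?_ hn (he.dia_mono α (fun f hf _ => by simp) ht)
    intro h
    exact hφ (he.dia_mono α (fun f hf => by simp) h)

theorem dia_or (he : IsSound e) (α : Word A P) (φ ψ : Form A P) :
    propEval e (dia α (or φ ψ)) ↔ propEval e (dia α φ) ∨ propEval e (dia α ψ) := by
  refine ⟨fun h => ?_, ?_⟩
  · by_contra! hn
    have h₁ := he _ (.distBox α (neg φ) ψ)
    simp only [propEval_imp, propEval_box, he.dia_not_not, he.dia_neg α ψ] at h₁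
    have h₂ : ¬ propEval e (dia α (neg (imp (neg φ) ψ))) := fun hx => by
      refine ((he.dia_neg α _).1 hx).2 (he.dia_mono α (fun f hf => ?_) h)
      simp [or_iff_not_imp_left]
    exact h₁ h₂ hn.1 ⟨he.dia_top α h, hn.2⟩
  · rintro (h | h)
    · exact he.dia_mono α (fun f _ hf => Or.inl hf) h
    · exact he.dia_mono α (fun f _ hf => Or.inr hf) h

theorem dia_atom (he : IsSound e) (α : Word A P) (p : P) :
    propEval e (dia α (atom p)) ↔ propEval e (dia α top) ∧ propEval e (atom p) := by
  have h := he _ (.perm α p)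
  simp only [propEval_and, propEval_imp, propEval_box, propEval_neg, he.dia_not_not,
    he.dia_neg] at h
  have := he.dia_top α (φ := atom p)
  tauto

theorem dia_ann_top (he : IsSound e) (α : Word A P) (φ : Form A P) :
    propEval e (dia α (ann φ top)) ↔ propEval e (dia α φ) :=
  he.dia_congr α fun _ hf => (propEval_iff _ _ _).1 (hf _ (.exec₁ φ))

theorem numRcv_lt_of_dia_rcv (he : IsSound e) (hempty : propEval e emptyForm) {α : Word A P}
    {a : A} {φ : Form A P} (h : propEval e (dia α (rcv a φ))) : numRcv a α < numSent α := by
  by_contra! hle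
  have h₁ := he _ (.exec₃ α a hle)
  rw [propEval_imp, propEval_box] at h₁
  refine h₁ hempty (he.dia_mono α (fun f hf hr => ?_) (he.dia_top (Sum.inl a :: α) h))
  rw [propEval_neg, propEval_boxRcv, not_not]
  exact hf.dia_mono [Sum.inl a] (φ := top) (ψ := neg bot) (fun f _ _ => by simp) hr

theorem dia_rcv_top (he : IsSound e) (hempty : propEval e emptyForm) (α : Word A P) (a : A) :
    propEval e (dia α (rcv a top)) ↔ propEval e (dia α top) ∧ numRcv a α < numSent α := by
  refine ⟨fun h => ⟨he.dia_top α h, he.numRcv_lt_of_dia_rcv hempty h⟩, fun ⟨ht, hlt⟩ => ?_⟩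
  by_contra hn
  exact he _ (.exec₂ α a hlt) ((he.dia_neg α _).2 ⟨ht, hn⟩)

theorem dia_poss (he : IsSound e) (hempty : propEval e emptyForm) (α : Word A P) (a : A)
    (φ : Form A P) : propEval e (dia α (poss a φ)) ↔ propEval e (dia α top) ∧
      ∃ β, View a α β ∧ ¬ propEval e (know a (box β (neg φ))) := by
  have h := he _ (.emptyBox α a (neg φ))
  have h₁ : propEval e (dia α (neg (know a (neg φ)))) ↔ propEval e (dia α (poss a φ)) :=
    he.dia_congr α fun f hf => by simp [hf.poss_not_not]
  have h₂ : propEval e (dia α (neg bot)) ↔ propEval e (dia α top) :=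
    he.dia_congr α fun f hf => by simp
  simp only [propEval_imp, propEval_iff, propEval_box _ α, propEval_or, propEval_conj, h₁, h₂,
    List.forall_mem_map, Finset.mem_toList, view, Set.Finite.mem_toFinset, Set.mem_ofPred_eq,
    hempty, true_imp_iff] at h
  rw [← not_iff_not, h]
  simp only [not_and_or, not_exists, not_not, imp_iff_not_or]

end IsSound

/-! ### The canonical model -/

/-- Worlds of the canonical model: sound assignments under which `empty` is true. -/
def CanonicalWorld (A : Type u) (P : Type v) [Fintype A] : Type (max u v) :=
  {e : Form A P → Prop // IsSound e ∧ propEval e emptyForm}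

namespace CanonicalWorld

/-- Truth of a formula in a canonical world. -/
def Holds (s : CanonicalWorld A P) (φ : Form A P) : Prop := propEval s.1 φ

/-- The canonical accessibility relation: what `a` knows in `s` is true in `t`. -/
def Rel (a : A) (s t : CanonicalWorld A P) : Prop := ∀ φ, s.Holds (know a φ) → t.Holds φ

theorem rel_equivalence (a : A) : Equivalence (Rel (P := P) a) where
  refl s φ h := by
    have := s.2.1 _ (.emptyT a φ)
    rw [propEval_imp, propEval_imp] at this
    exact this s.2.2 h
  symm {s t} hst φ h := by
    -- Otherwise `K̂_a ¬φ` holds in `s`, hence `K_a K̂_a ¬φ` by (5), so `K̂_a ¬φ` holds in `t`.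
    have hT := s.2.1 _ (.emptyT a φ)
    rw [propEval_imp, propEval_imp] at hT
    refine hT s.2.2 fun hp => h (hst _ ?_)
    exact (propEval_imp _ _ _).1 (s.2.1 _ (.five a (neg φ))) hp
  trans {s t u} hst htu φ h :=
    htu φ (hst _ ((propEval_imp _ _ _).1 (s.2.1 _ (.four a φ)) h))

theorem holds_poss (s : CanonicalWorld A P) (a : A) (φ : Form A P) :
    s.Holds (poss a φ) ↔ ∃ t, Rel a s t ∧ t.Holds φ := by
  have hnn := s.2.1.poss_not_not a φ
  constructor
  · intro h
    have hK : neg φ ∉ {χ : Form A P | s.Holds (know a χ)} := fun hk => hk (hnn.2 h)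
    obtain ⟨f, hf, hφ⟩ := exists_propEval_of_notMem (Γ := {χ : Form A P | s.Holds (know a χ)})
      (fun χ hχ => s.2.1 _ (.necK a (.taut hχ)))
      (fun χ ψ hχ hψ => by
        have := s.2.1 _ (.distK a χ ψ)
        rw [propEval_imp, propEval_imp] at this
        exact this hψ hχ) hK
    refine ⟨⟨f, fun χ hχ => hf χ (s.2.1 _ (.necK a hχ)), hf _ ?_⟩, hf, not_not.1 hφ⟩
    exact (propEval_imp _ _ _).1 (s.2.1 _ (.emptyK a)) s.2.2
  · rintro ⟨t, hst, ht⟩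
    by_contra h
    exact hst (neg φ) (fun hp => h (hnn.1 hp)) ht

end CanonicalWorld

theorem exists_canonicalWorld_of_not_derivable {φ : Form A P}
    (h : ¬ Derivable (imp emptyForm φ)) : ∃ s : CanonicalWorld A P, ¬ s.Holds φ := by
  by_contra! hs
  refine h (derivable_of_isSound fun e he => ?_)
  rw [propEval_imp]
  exact fun hempty => hs ⟨e, he, hempty⟩

/-- The canonical model. -/
abbrev canonicalModel (h : Nonempty (CanonicalWorld A P)) : Model.{u, v, max u v} A P where
  W := CanonicalWorld A P
  nonempty := h
  rel := CanonicalWorld.Rel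
  equiv := CanonicalWorld.rel_equivalence
  val p := {s | s.Holds (atom p)}

/-! ### The truth lemma -/

mutual

theorem exec_canonical (h : Nonempty (CanonicalWorld A P)) (s : CanonicalWorld A P) :
    ∀ α : Word A P, Exec (canonicalModel h) s α ↔ s.Holds (dia α top)
  | [] => by
    rw [exec_nil]
    exact (propEval_top _).symm
  | Sum.inl a :: α => by
    rw [exec_inl, exec_canonical h s α]
    exact (s.2.1.dia_rcv_top s.2.2 α a).symm
  | Sum.inr φ :: α => by
    rw [exec_inr, exec_canonical h s α, sat_canonical h s α φ]
    exact (and_iff_right_of_imp (s.2.1.dia_top α)).trans (s.2.1.dia_ann_top α φ).symm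
termination_by α => (Word.deg α, Word.size α, 1)
decreasing_by
  · rw [Word.deg_inl]
    exact Prod.Lex.right _ (Prod.Lex.left _ _ (by simp [Word.size]))
  · rw [Word.deg_inr]
    have := φ.size_pos
    rcases Nat.eq_zero_or_pos φ.deg with h | h
    · rw [h]
      exact Prod.Lex.right _ (Prod.Lex.left _ _ (by simp only [Word.size]; omega))
    · exact Prod.Lex.left _ _ (by omega)
  · rw [Word.deg_inr]
    exact Prod.Lex.right _ (Prod.Lex.right _ (by omega))

theorem sat_canonical (h : Nonempty (CanonicalWorld A P)) (s : CanonicalWorld A P)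
    (α : Word A P) : ∀ φ : Form A P, Sat (canonicalModel h) s α φ ↔ s.Holds (dia α φ)
  | Form.atom p => by
    rw [sat_atom, exec_canonical h s α]
    exact (s.2.1.dia_atom α p).symm
  | Form.top => by rw [sat_top, exec_canonical h s α]
  | Form.neg φ => by
    rw [sat_neg, exec_canonical h s α, sat_canonical h s α φ]
    exact (s.2.1.dia_neg α φ).symm
  | Form.or φ ψ => by
    rw [sat_or, sat_canonical h s α φ, sat_canonical h s α ψ]
    exact (s.2.1.dia_or α φ ψ).symm
  | Form.poss a φ => by
    have key (β : Word A P) : ¬ s.Holds (know a (box β (neg φ))) ↔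
        ∃ t, CanonicalWorld.Rel a s t ∧ t.Holds (dia β φ) := by
      have h₁ : ¬ s.Holds (know a (box β (neg φ))) ↔
          s.Holds (poss a (neg (box β (neg φ)))) := not_not
      rw [h₁, CanonicalWorld.holds_poss]
      refine exists_congr fun t => and_congr_right fun _ => ?_
      exact not_not.trans (t.2.1.dia_not_not β φ)
    -- The hypothesis `hβ` bounds the depth of `β`, which makes the recursive calls legitimate.
    have hiff (t : CanonicalWorld A P) (β : Word A P) (hβ : Word.View a α β) :
        Exec (canonicalModel h) t β ∧ Sat (canonicalModel h) t β φ ↔ t.Holds (dia β φ) := by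
      rw [exec_canonical h t β, sat_canonical h t β φ]
      exact and_iff_right_of_imp (t.2.1.dia_top β)
    rw [sat_poss, exec_canonical h s α]
    refine Iff.trans (and_congr_right fun _ => ?_) (s.2.1.dia_poss s.2.2 α a φ).symm
    constructor
    · rintro ⟨t, β, hst, hβ, ht⟩
      exact ⟨β, hβ, (key β).2 ⟨t, hst, (hiff t β hβ).1 ht⟩⟩
    · rintro ⟨β, hβ, hk⟩
      obtain ⟨t, hst, ht⟩ := (key β).1 hk
      exact ⟨t, β, hst, hβ, (hiff t β hβ).2 ht⟩
  | Form.rcv a φ => by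
    rw [sat_rcv, sat_canonical h s (Sum.inl a :: α) φ]
    exact and_iff_right_of_imp (s.2.1.numRcv_lt_of_dia_rcv s.2.2)
  | Form.ann ψ φ => by
    rw [sat_ann, sat_canonical h s α ψ, sat_canonical h s (Sum.inr ψ :: α) φ]
    exact and_iff_right_of_imp fun hd =>
      (s.2.1.dia_ann_top α ψ).1 (s.2.1.dia_top (Sum.inr ψ :: α) hd)
termination_by φ => (Word.deg α + φ.deg, Word.size α + φ.size, 0)
decreasing_by
  all_goals simp only [Prod.lex_def, Form.deg, Form.size, Word.deg_inl, Word.deg_inr, Word.size,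
    true_and]
  all_goals first
    | omega
    | (have h1 := Form.size_pos φ; have h2 := Form.size_pos ψ; omega)
    | (have := Word.deg_le_of_view ‹Word.View _ _ _›; omega)

end

end Completeness

end AsyncAnn

theorem mainTheorem1 {A : Type u} {P : Type v} [Fintype A] [Nontrivial A] [Countable P]
    (φ : AsyncAnn.Form A P) (h : AsyncAnn.AlwaysValid.{u, v, max u v} φ) :
    AsyncAnn.Derivable φ := by
  refine .rStar fun α => ?_
  by_contra hα
  obtain ⟨s, hs⟩ := AsyncAnn.exists_canonicalWorld_of_not_derivable hα
  exact hs ((AsyncAnn.sat_canonical ⟨s⟩ s [] _).1 (h α (AsyncAnn.canonicalModel ⟨s⟩) s))
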